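/- Let $(X,\mu)$ be a measure space and let $H$ be a separable complex Hilbert space of ($\mu$-a.e. classes of) measurable functions $X\to\mathbb C$ such that $\operatorname{Re}u\in H$ and $(\operatorname{Re}u\mid\operatorname{Im}u)_H\in\mathbb R$ for all $u\in H$ (for instance $H=L^2(X,\mu)$, when separable). Let $V$ be a separable complex Hilbert space that is continuously and densely imbedded in $H$. Scalar products $(\cdot\mid\cdot)$ and sesquilinear forms are linear in the first and antilinear in the second variable. Denote by $V_{\mathbb R}$ and $H_{\mathbb R}$ the sets of real-valued functions in $V$ and $H$. Let $a,b:V\times V\to\mathbb C$ be sesquilinear forms that are continuous, i.e. $|a(u,v)|\le M_a\|u\|_V\|v\|_V$ and $|b(u,v)|\le M_b\|u\|_V\|v\|_V$ for some constants $M_a,M_b$ and all $u,v\in V$, and let $b$ be $H$-elliptic, i.e. $\operatorname{Re}b(u,u)\ge\alpha\|u\|_V^2-\omega\|u\|_H^2$ for some $\alpha>0$, $\omega\in\mathbb R$ and all $u\in V$. On the Hilbert space $\mathbf H=V\times H$ consider the form with domain $\mathbf V=V\times V$, $$\mathbf a(\mathbf u,\mathbf v)=-(u_2\mid v_1)_V+a(u_1,v_2)+b(u_2,v_2),\qquad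 \mathbf u=(u_1,u_2),\ \mathbf v=(v_1,v_2)\in\mathbf V .$$ The operator $B$ on $H$ associated with $b$ is given by: $f\in D(B)$ and $Bf=h$ if and only if $f\in V$, $h\in H$ and $b(f,g)=(h\mid g)_H$ for all $g\in V$. The operator $\mathbf A$ on $\mathbf H$ associated with $\mathbf a$ is defined in the same way, with $\mathbf V,\mathbf H,\mathbf a$ in place of $V,H,b$. The semigroup associated with $b$ (resp. $\mathbf a$), denoted by $(e^{-tb})_{t\ge0}$ (resp. $(e^{-t\mathbf a})_{t\ge0}$), is the $C_0$-semigroup on $H$ (resp. $\mathbf H$) with generator $-B$ (resp. $-\mathbf A$). Assume further that, for all $u\in V$, $\operatorname{Re}u\in V$ and $a(\operatorname{Re}u,\operatorname{Im}u)$ and $(\operatorname{Re}u\mid\operatorname{Im}u)_V$ are real. Then both semigroups exist and are uniquely determined, and $(e^{-t\mathbf a})_{t\ge0}$ leaves $V_{\mathbb R}\times H_{\mathbb R}$ invariant if and only if $(e^{-tb})_{t\ge0}$ leaves $H_{\mathbb R}$ invariant. -/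

import Mathlib

open MeasureTheory Filter Topology
open scoped NNReal

namespace DampedWave

/-! ### Sesquilinear forms

A form is linear in the first and antilinear in the second variable. Mathlib's `inner ℂ x y` is
antilinear in `x`, so the scalar product `(x ∣ y)` of the text, linear in `x`, is `inner ℂ y x`. -/

section Forms

variable {V H : Type*}
  [NormedAddCommGroup V] [InnerProductSpace ℂ V]
  [NormedAddCommGroup H] [InnerProductSpace ℂ H]

/-- `|a(u,v)| ≤ M ‖u‖ ‖v‖` for some constant `M`. -/
def IsContinuousForm (a : V →ₗ[ℂ] V →ₗ⋆[ℂ] ℂ) : Prop :=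
  ∃ M : ℝ, ∀ u v : V, ‖a u v‖ ≤ M * ‖u‖ * ‖v‖

/-- `H`-ellipticity of a form on `V`, where `j : V → H` is the imbedding:
`Re a(u,u) ≥ α ‖u‖_V² - ω ‖u‖_H²` for some `α > 0` and `ω ∈ ℝ`. -/
def IsElliptic (j : V →L[ℂ] H) (a : V →ₗ[ℂ] V →ₗ⋆[ℂ] ℂ) : Prop :=
  ∃ α : ℝ, 0 < α ∧ ∃ ω : ℝ, ∀ u : V, α * ‖u‖ ^ 2 - ω * ‖j u‖ ^ 2 ≤ (a u u).re

/-- The graph of the operator `A` on `H` associated with the form `a` on `V`: `x ∈ D(A)` and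
`A x = h` iff `x` is (the image of) some `f ∈ V` with `a(f,g) = (h ∣ g)_H` for all `g ∈ V`. -/
def InOperatorGraph (j : V →L[ℂ] H) (a : V →ₗ[ℂ] V →ₗ⋆[ℂ] ℂ) (x h : H) : Prop :=
  ∃ f : V, j f = x ∧ ∀ g : V, a f g = inner ℂ (j g) h

/-- If `V` is densely imbedded in `H`, the associated operator is single-valued. -/
theorem InOperatorGraph.unique {j : V →L[ℂ] H} (hj : Function.Injective j) (hd : DenseRange j)
    {a : V →ₗ[ℂ] V →ₗ⋆[ℂ] ℂ} {x h h' : H}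
    (h1 : InOperatorGraph j a x h) (h2 : InOperatorGraph j a x h') : h = h' := by
  obtain ⟨f, hf, hfg⟩ := h1
  obtain ⟨f', hf', hfg'⟩ := h2
  obtain rfl : f = f' := hj (hf.trans hf'.symm)
  refine hd.eq_of_inner_left ℂ fun g => ?_
  rw [← inner_conj_symm, ← hfg g, hfg' g, inner_conj_symm]

end Forms

/-! ### Semigroups -/

/-- Strongly continuous one-parameter semigroups of bounded linear operators. -/
structure IsC0Semigroup {H : Type*} [NormedAddCommGroup H] [NormedSpace ℂ H]
    (T : ℝ≥0 → H →L[ℂ] H) : Prop where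
  zero : T 0 = ContinuousLinearMap.id ℂ H
  add : ∀ s t : ℝ≥0, T (s + t) = (T s).comp (T t)
  tendsto : ∀ x : H, Tendsto (fun t => T t x) (𝓝[>] 0) (𝓝 x)

/-- `y` is the value at `x` of the infinitesimal generator of `T`. -/
def InGeneratorGraph {H : Type*} [NormedAddCommGroup H] [NormedSpace ℂ H]
    (T : ℝ≥0 → H →L[ℂ] H) (x y : H) : Prop :=
  Tendsto (fun t : ℝ≥0 => (t : ℝ)⁻¹ • (T t x - x)) (𝓝[>] 0) (𝓝 y)

/-- `T` is the semigroup `(e^{-ta})_{t ≥ 0}` on `H` associated with the form `a` on `V`: a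
`C₀`-semigroup whose generator is exactly `-A`, where `A` is the operator associated with `a`. -/
def IsSemigroupOfForm {V H : Type*} [NormedAddCommGroup V] [InnerProductSpace ℂ V]
    [NormedAddCommGroup H] [InnerProductSpace ℂ H]
    (j : V →L[ℂ] H) (a : V →ₗ[ℂ] V →ₗ⋆[ℂ] ℂ) (T : ℝ≥0 → H →L[ℂ] H) : Prop :=
  IsC0Semigroup T ∧ ∀ x h : H, InGeneratorGraph T x (-h) ↔ InOperatorGraph j a x h

/-! ### The form governing the damped wave equation

`WithLp 2 (V × W)` is the product with its canonical Hilbert space structure. -/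

section Product

variable {V H : Type*}
  [NormedAddCommGroup V] [InnerProductSpace ℂ V]
  [NormedAddCommGroup H] [InnerProductSpace ℂ H]

/-- The imbedding of `V × V` into `V × H`. -/
noncomputable def energyEmbedding (j : V →L[ℂ] H) :
    WithLp 2 (V × V) →L[ℂ] WithLp 2 (V × H) :=
  (WithLp.prodContinuousLinearEquiv 2 ℂ V H).symm.toContinuousLinearMap.comp
    (((ContinuousLinearMap.id ℂ V).prodMap j).comp
      (WithLp.prodContinuousLinearEquiv 2 ℂ V V).toContinuousLinearMap)

/-- The form `(u, v) ↦ -(u₂ ∣ v₁)_V + a(u₁, v₂) + b(u₂, v₂)` on `V × V`. -/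
noncomputable def energyForm (a b : V →ₗ[ℂ] V →ₗ⋆[ℂ] ℂ) :
    WithLp 2 (V × V) →ₗ[ℂ] WithLp 2 (V × V) →ₗ⋆[ℂ] ℂ :=
  LinearMap.mk₂'ₛₗ (RingHom.id ℂ) (starRingEnd ℂ)
    (fun u v => -inner ℂ v.fst u.snd + a u.fst v.snd + b u.snd v.snd)
    (fun u u' v => by simp; ring)
    (fun c u v => by simp; ring)
    (fun u v v' => by simp; ring)
    (fun c u v => by simp; ring)

end Product

/-! ### Real and imaginary parts in function spaces

A function space `E` over the measure space `(X, μ)` is a vector space `E` together with an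
injective linear map `ι` into the almost everywhere classes of measurable functions `X → ℂ`. -/

section Real

variable {X : Type*} [MeasurableSpace X] {μ : Measure X} {E : Type*} [AddCommGroup E] [Module ℂ E]

/-- The element `p` of `E` is the function `Re u`. -/
def IsRe (ι : E →ₗ[ℂ] (X →ₘ[μ] ℂ)) (u p : E) : Prop :=
  ∀ᵐ x ∂μ, ι p x = ((ι u x).re : ℂ)

/-- The element `q` of `E` is the function `Im u`. -/
def IsIm (ι : E →ₗ[ℂ] (X →ₘ[μ] ℂ)) (u q : E) : Prop :=
  ∀ᵐ x ∂μ, ι q x = ((ι u x).im : ℂ)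

/-- The set `E_ℝ` of real-valued functions in `E`. -/
def realFunctions (ι : E →ₗ[ℂ] (X →ₘ[μ] ℂ)) : Set E :=
  {u | ∀ᵐ x ∂μ, (ι u x).im = 0}

end Real

end DampedWave

open DampedWave

/-! Reality is expressed by conjugations. Stability under `Re` gives antilinear involutions `CV` and
`CH` of `V` and `H`, intertwined by `j`, whose fixed vectors are the real functions; the reality of
the scalar products makes them isometric.

The heart is `IsSemigroupOfForm.forall_fixed_iff`: the semigroup of an elliptic form preserves fixed
vectors iff the form satisfies a(Cu,Cv) = conj a(u,v). If the semigroup is real, it commutes with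
the conjugation, hence so does its generator; this yields the identity for u in the operator domain,
which is dense in `V` for the norm of `V`, and continuity of the form extends it. Conversely, if the
form is real, the conjugated semigroup has the same generator, so it is the same semigroup.

This applies to `b`, and to the energy form with the conjugations `CV × CV` and `CV × CH`. Since the
scalar product of `V` and `a` are real, the energy form is real exactly when `b` is
(`energyForm_prodMapL2_iff`), so the two invariance properties are equivalent.

Existence and uniqueness hold for every elliptic form. The energy form is elliptic because the
ambient norm controls the first component in `V`. After a shift by `ω`, Lax–Milgram makes the
associated operator `m`-accretive, and Yosida approximation produces the semigroup
(`IsMAccretive.exists_semigroup`). Uniqueness is a Gronwall estimate for the difference of two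
orbits. -/

/-- A continuous curve whose right derivative is `ω`-dissipative along the curve grows at most
like `e^{ωt}`. -/
theorem norm_sq_le_exp_mul_of_re_inner_deriv_le {H : Type*} [NormedAddCommGroup H]
    [InnerProductSpace ℂ H] {u u' : ℝ → H} {ω b : ℝ}
    (hu : ContinuousOn u (Set.Icc 0 b))
    (hu' : ∀ t ∈ Set.Ico 0 b, HasDerivWithinAt u (u' t) (Set.Ici t) t)
    (hdiss : ∀ t ∈ Set.Ico 0 b, (inner ℂ (u t) (u' t)).re ≤ ω * ‖u t‖ ^ 2) :
    ∀ t ∈ Set.Icc 0 b, ‖u t‖ ^ 2 ≤ ‖u 0‖ ^ 2 * Real.exp (2 * ω * t) := by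
  intro t ht
  have := le_gronwallBound_of_liminf_deriv_right_le (f := fun t => ‖u t‖ ^ 2)
    (f' := fun t => 2 * (inner ℂ (u t) (u' t)).re) (δ := ‖u 0‖ ^ 2) (K := 2 * ω) (ε := 0)
    (a := 0) (b := b) (hu.norm.pow 2) ?_ le_rfl ?_ t ht
  · simpa [gronwallBound_ε0] using this
  · intro s hs r hr
    have h : HasDerivWithinAt (fun t => ‖u t‖ ^ 2) (2 * (inner ℂ (u s) (u' s)).re)
        (Set.Ici s) s := by
      let := InnerProductSpace.rclikeToReal ℂ H
      simpa [real_inner_eq_re_inner ℂ] using HasDerivWithinAt.norm_sq (F := H) (hu' s hs)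
    have h2 := (hasDerivWithinAt_iff_tendsto_slope' (Set.self_notMem_Ioi)).1
      h.Ioi_of_Ici
    refine ((h2.eventually_lt_const hr).mono fun z hz => ?_).frequently
    simpa [slope_def_field, div_eq_inv_mul] using hz
  · intro s hs
    have := hdiss s hs
    linarith

namespace DampedWave

/-! ### Orbits and generators of `C₀`-semigroups -/

section Banach

variable {H : Type*} [NormedAddCommGroup H] [NormedSpace ℂ H] {T : ℝ≥0 → H →L[ℂ] H}

theorem IsC0Semigroup.add_apply (hT : IsC0Semigroup T) (s t : ℝ≥0) (x : H) :
    T (s + t) x = T s (T t x) := by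
  rw [hT.add]; rfl

theorem IsC0Semigroup.tendsto_nhds_zero (hT : IsC0Semigroup T) (x : H) :
    Tendsto (fun t => T t x) (𝓝 0) (𝓝 x) := by
  have h : ContinuousWithinAt (fun t => T t x) (Set.Ioi 0) 0 := by
    simpa [ContinuousWithinAt, hT.zero] using hT.tendsto x
  have h2 := continuousWithinAt_Ioi_iff_Ici.1 h
  have h3 : Set.Ici (0 : ℝ≥0) = Set.univ := by ext; simp
  rw [h3, continuousWithinAt_univ] at h2
  simpa [ContinuousAt, hT.zero] using h2

/-- Otherwise there are times tending to 0 along which the operator norms are unbounded, although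
every orbit converges there; this contradicts uniform boundedness. -/
theorem IsC0Semigroup.exists_norm_le_near_zero [CompleteSpace H] (hT : IsC0Semigroup T) :
    ∃ δ : ℝ≥0, 0 < δ ∧ ∃ M : ℝ, ∀ t ≤ δ, ‖T t‖ ≤ M := by
  by_contra! hcon
  choose t ht htn using fun n : ℕ => hcon (1 / (n + 1)) (by positivity) n
  have ht0 : Tendsto t atTop (𝓝 0) :=
    tendsto_of_tendsto_of_tendsto_of_le_of_le tendsto_const_nhds
      tendsto_one_div_add_atTop_nhds_zero_nat (fun n => zero_le) ht
  obtain ⟨C, hC⟩ := banach_steinhaus (g := fun n => T (t n)) fun x => by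
    obtain ⟨C, hC⟩ := ((hT.tendsto_nhds_zero x).comp ht0).norm.bddAbove_range
    exact ⟨C, fun n => hC ⟨n, rfl⟩⟩
  obtain ⟨n, hn⟩ := exists_nat_gt C
  exact absurd (hC n) (not_le.2 (hn.trans (htn n)))

theorem IsC0Semigroup.exists_norm_le [CompleteSpace H] (hT : IsC0Semigroup T) (b : ℝ≥0) :
    ∃ M : ℝ, ∀ t ≤ b, ‖T t‖ ≤ M := by
  obtain ⟨δ, hδ, C, hC⟩ := hT.exists_norm_le_near_zero
  have key : ∀ n : ℕ, ∃ M : ℝ, ∀ t ≤ n * δ, ‖T t‖ ≤ M := by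
    intro n
    induction n with
    | zero => exact ⟨C, fun t ht => hC t (by simp at ht; simp [ht])⟩
    | succ n ih =>
      obtain ⟨M, hM⟩ := ih
      refine ⟨max C (M * C), fun t ht => ?_⟩
      rcases le_total t δ with h | h
      · exact (hC t h).trans (le_max_left _ _)
      · refine le_trans ?_ (le_max_right _ _)
        have h1 : t - δ ≤ n * δ := by
          rw [tsub_le_iff_right]; push_cast at ht; linarith
        rw [← tsub_add_cancel_of_le h, hT.add]
        refine (ContinuousLinearMap.opNorm_comp_le _ _).trans ?_
        have := hM _ h1
        exact mul_le_mul this (hC δ le_rfl) (norm_nonneg _) ((norm_nonneg _).trans this)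
  obtain ⟨n, hn⟩ := exists_nat_gt (b / δ)
  obtain ⟨M, hM⟩ := key n
  exact ⟨M, fun t ht => hM t (ht.trans ((div_lt_iff₀ hδ).1 hn).le)⟩

/-- For r ≤ s, T(s)x − T(r)x = T(r)(T(s−r)x − x), so the local norm bound reduces two-sided
continuity to continuity at 0. -/
theorem IsC0Semigroup.continuous [CompleteSpace H] (hT : IsC0Semigroup T) (x : H) :
    Continuous fun t => T t x := by
  rw [continuous_iff_continuousAt]
  intro t
  obtain ⟨M, hM⟩ := hT.exists_norm_le (t + 1)
  have hmono : ∀ r s : ℝ≥0, r ≤ s → r ≤ t + 1 → ‖T s x - T r x‖ ≤ M * ‖T (s - r) x - x‖ := by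
    intro r s hrs hr
    rw [← add_tsub_cancel_of_le hrs, hT.add_apply, ← map_sub, add_tsub_cancel_of_le hrs]
    exact (T r).le_of_opNorm_le (hM r hr) _
  have hlim : Tendsto (fun s => M * ‖T (nndist s t) x - x‖) (𝓝 t) (𝓝 0) := by
    have h1 : Tendsto (fun s : ℝ≥0 => nndist s t) (𝓝 t) (𝓝 0) := by
      have : Continuous fun s : ℝ≥0 => nndist s t := by fun_prop
      simpa using this.tendsto t
    have h2 := ((hT.tendsto_nhds_zero x).comp h1).sub_const x
    simpa using h2.norm.const_mul M
  rw [ContinuousAt, tendsto_iff_norm_sub_tendsto_zero]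
  refine squeeze_zero' (Eventually.of_forall fun _ => norm_nonneg _) ?_ hlim
  filter_upwards [eventually_le_nhds (show t < t + 1 by simp)] with s hs
  have hd : ∀ r s : ℝ≥0, r ≤ s → nndist s r = s - r := by
    intro r s hrs
    rw [NNReal.nndist_eq, tsub_eq_zero_of_le hrs]; simp
  rcases le_total s t with h | h
  · rw [nndist_comm, hd _ _ h, norm_sub_rev]
    exact hmono s t h hs
  · rw [hd _ _ h]
    exact hmono t s h (by simp)

theorem InGeneratorGraph.sub {x y x' y' : H} (h : InGeneratorGraph T x y)
    (h' : InGeneratorGraph T x' y') : InGeneratorGraph T (x - x') (y - y') := by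
  refine (Tendsto.sub h h').congr fun t => ?_
  rw [← smul_sub, map_sub]; congr 1; abel

theorem InGeneratorGraph.orbit (hT : IsC0Semigroup T) {x y : H} (h : InGeneratorGraph T x y)
    (s : ℝ≥0) : InGeneratorGraph T (T s x) (T s y) := by
  refine (((T s).continuous.tendsto y).comp h).congr fun t => ?_
  have : T s (T t x) = T t (T s x) := by rw [← hT.add_apply, ← hT.add_apply, add_comm]
  simp only [Function.comp, ← this, ← map_sub]
  exact (T s).map_smul_of_tower _ _

/-- The generator commutes with the semigroup, so the limit at time 0 can be moved to time t. The
right derivative is all that the Gronwall estimate needs. -/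
theorem InGeneratorGraph.hasDerivWithinAt (hT : IsC0Semigroup T) {x y : H}
    (h : InGeneratorGraph T x y) {t : ℝ} (ht : 0 ≤ t) :
    HasDerivWithinAt (fun s : ℝ => T s.toNNReal x) (T t.toNNReal y) (Set.Ici t) t := by
  refine HasDerivWithinAt.Ici_of_Ioi ?_
  rw [hasDerivWithinAt_iff_tendsto_slope' Set.self_notMem_Ioi]
  have hlim : Tendsto (fun s : ℝ => (s - t).toNNReal) (𝓝[>] t) (𝓝[>] 0) := by
    refine tendsto_nhdsWithin_iff.2 ⟨?_, ?_⟩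
    · have : Continuous fun s : ℝ => (s - t).toNNReal := by fun_prop
      simpa using (this.tendsto t).mono_left nhdsWithin_le_nhds
    · filter_upwards [self_mem_nhdsWithin] with s hs
      simpa using hs
  refine ((h.orbit hT t.toNNReal).comp hlim).congr' ?_
  filter_upwards [self_mem_nhdsWithin] with s hs
  have hs : t < s := hs
  have h1 : s.toNNReal = (s - t).toNNReal + t.toNNReal := by
    rw [← Real.toNNReal_add (by linarith) ht]; congr 1; ring
  simp only [Function.comp, slope, vsub_eq_sub, h1, hT.add_apply]
  rw [Real.coe_toNNReal _ (by linarith)]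

end Banach

/-- A `C₀`-semigroup is determined by its generator, if that is quasi-dissipative and densely
defined. -/
theorem IsC0Semigroup.eq_of_generator {H : Type*} [NormedAddCommGroup H] [InnerProductSpace ℂ H]
    [CompleteSpace H] {T T' : ℝ≥0 → H →L[ℂ] H} (hT : IsC0Semigroup T) (hT' : IsC0Semigroup T')
    {G : H → H → Prop} (hG : ∀ x y, InGeneratorGraph T x y ↔ G x y)
    (hG' : ∀ x y, InGeneratorGraph T' x y ↔ G x y)
    {ω : ℝ} (hdiss : ∀ x y, G x y → (inner ℂ x y).re ≤ ω * ‖x‖ ^ 2)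
    (hdense : Dense {x | ∃ y, G x y}) : T = T' := by
  ext t x
  revert x
  rw [← funext_iff]
  refine Continuous.ext_on hdense (T t).continuous (T' t).continuous ?_
  rintro x ⟨y, hxy⟩
  have h1 := (hG x y).2 hxy
  have h2 := (hG' x y).2 hxy
  have := norm_sq_le_exp_mul_of_re_inner_deriv_le (ω := ω) (b := t)
    (u := fun s => T s.toNNReal x - T' s.toNNReal x)
    (u' := fun s => T s.toNNReal y - T' s.toNNReal y)
    (((hT.continuous x).comp continuous_real_toNNReal).sub
      ((hT'.continuous x).comp continuous_real_toNNReal)).continuousOn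
    (fun s hs => (h1.hasDerivWithinAt hT hs.1).sub (h2.hasDerivWithinAt hT' hs.1))
    -- Both orbits stay in the common generator graph `G`, so their difference is again a point of
    -- `G`, where dissipativity applies.
    (fun s hs => hdiss _ _ ((hG _ _).1
      ((h1.orbit hT _).sub ((hG _ _).2 ((hG' _ _).1 (h2.orbit hT' _))))))
    t ⟨t.2, le_rfl⟩
  simpa [hT.zero, hT'.zero, sub_eq_zero] using this

/-! ### Limits of contractions and comparison of exponentials -/

section Approximation

variable {H : Type*} [NormedAddCommGroup H] [NormedSpace ℂ H]

theorem tendsto_of_dense_of_norm_le {ι : Type*} {l : Filter ι} {L : ι → H →L[ℂ] H}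
    {S : H →L[ℂ] H} (hL : ∀ᶠ i in l, ∀ x, ‖L i x‖ ≤ ‖x‖) (hS : ∀ x, ‖S x‖ ≤ ‖x‖) {D : Set H}
    (hD : Dense D) (h : ∀ x ∈ D, Tendsto (fun i => L i x) l (𝓝 (S x))) (x : H) :
    Tendsto (fun i => L i x) l (𝓝 (S x)) := by
  rw [Metric.tendsto_nhds]
  intro ε hε
  obtain ⟨z, hz, hxz⟩ := Metric.dense_iff.1 hD x (ε / 3) (by positivity)
  rw [Metric.mem_ball, dist_eq_norm, norm_sub_rev] at hz
  filter_upwards [hL, Metric.tendsto_nhds.1 (h z hxz) (ε / 3) (by positivity)] with i hi hiz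
  rw [dist_eq_norm] at hiz ⊢
  have : L i x - S x = L i (x - z) + (L i z - S z) - S (x - z) := by simp
  rw [this]
  have h1 := norm_sub_le (L i (x - z) + (L i z - S z)) (S (x - z))
  have h2 := norm_add_le (L i (x - z)) (L i z - S z)
  have h3 := hi (x - z)
  have h4 := hS (x - z)
  linarith

theorem exists_tendsto_of_dense_of_norm_le [CompleteSpace H] {L : ℕ → H →L[ℂ] H}
    (hL : ∀ n x, ‖L n x‖ ≤ ‖x‖) {D : Set H} (hD : Dense D)
    (h : ∀ x ∈ D, CauchySeq fun n => L n x) :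
    ∃ S : H →L[ℂ] H, (∀ x, ‖S x‖ ≤ ‖x‖) ∧ ∀ x, Tendsto (fun n => L n x) atTop (𝓝 (S x)) := by
  have hc : ∀ x, CauchySeq fun n => L n x := by
    intro x
    rw [Metric.cauchySeq_iff]
    intro ε hε
    obtain ⟨z, hz, hxz⟩ := Metric.dense_iff.1 hD x (ε / 3) (by positivity)
    rw [Metric.mem_ball, dist_eq_norm, norm_sub_rev] at hz
    obtain ⟨N, hN⟩ := Metric.cauchySeq_iff.1 (h z hxz) (ε / 3) (by positivity)
    refine ⟨N, fun m hm n hn => ?_⟩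
    have hiz := hN m hm n hn
    rw [dist_eq_norm] at hiz ⊢
    have : L m x - L n x = L m (x - z) + (L m z - L n z) - L n (x - z) := by simp
    rw [this]
    have h1 := norm_sub_le (L m (x - z) + (L m z - L n z)) (L n (x - z))
    have h2 := norm_add_le (L m (x - z)) (L m z - L n z)
    have h3 := hL m (x - z)
    have h4 := hL n (x - z)
    linarith
  choose f hf using fun x => cauchySeq_tendsto_of_complete (hc x)
  refine ⟨continuousLinearMapOfTendsto L (tendsto_pi_nhds.2 hf), fun x => ?_, hf⟩
  exact le_of_tendsto (hf x).norm (Eventually.of_forall fun n => hL n x)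

/-- Comparison of the exponentials of two commuting generators of contraction semigroups. -/
theorem norm_exp_sub_exp_le [CompleteSpace H] {P Q : H →L[ℂ] H} (hPQ : Commute P Q)
    (hP : ∀ t : ℝ, 0 ≤ t → ∀ x, ‖NormedSpace.exp (t • P) x‖ ≤ ‖x‖)
    (hQ : ∀ t : ℝ, 0 ≤ t → ∀ x, ‖NormedSpace.exp (t • Q) x‖ ≤ ‖x‖) {t : ℝ} (ht : 0 ≤ t) (x : H) :
    ‖NormedSpace.exp (t • P) x - NormedSpace.exp (t • Q) x‖ ≤ t * ‖P x - Q x‖ := by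
  -- The curve exp(sP) exp((t−s)Q)x joins exp(tQ)x to exp(tP)x. Commutation moves P − Q next to x,
  -- so contractivity bounds the speed by ‖Px − Qx‖.
  have hd : ∀ s : ℝ, HasDerivAt
      (fun s : ℝ => (NormedSpace.exp (s • P) * NormedSpace.exp ((t - s) • Q)) x)
      ((NormedSpace.exp (s • P) * NormedSpace.exp ((t - s) • Q)) (P x - Q x)) s := by
    intro s
    have h1 := hasDerivAt_exp_smul_const (𝕂 := ℝ) P s
    have h2 : HasDerivAt (fun s : ℝ => NormedSpace.exp ((t - s) • Q))
        (-(Q * NormedSpace.exp ((t - s) • Q))) s := by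
      have := (hasDerivAt_exp_smul_const' (𝕂 := ℝ) Q (t - s)).scomp s
        ((hasDerivAt_id s).const_sub t)
      exact this.congr_deriv (by simp)
    have h3 := h1.mul h2
    have h4 := ((ContinuousLinearMap.apply ℂ H x).restrictScalars ℝ).hasFDerivAt.comp_hasDerivAt s h3
    have hcPQ : Commute P (NormedSpace.exp ((t - s) • Q)) :=
      (hPQ.smul_right (t - s)).exp_right
    have hcQQ : Commute Q (NormedSpace.exp ((t - s) • Q)) :=
      ((Commute.refl Q).smul_right (t - s)).exp_right
    refine h4.congr_deriv ?_
    rw [mul_assoc, hcPQ.eq, hcQQ.eq]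
    simp [sub_eq_add_neg]
  have := norm_image_sub_le_of_norm_deriv_le_segment' (a := 0) (b := t) (C := ‖P x - Q x‖)
    (fun s _ => (hd s).hasDerivWithinAt) (fun s hs => ?_) t ⟨ht, le_rfl⟩
  · simpa [mul_comm] using this
  · exact (hP s hs.1 _).trans (hQ (t - s) (by linarith [hs.2]) _)

end Approximation

/-! ### Accretive operators and their resolvents -/

section Accretive

variable {H : Type*} [NormedAddCommGroup H] [InnerProductSpace ℂ H]

theorem norm_exp_neg_le_of_accretive [CompleteSpace H] {Y : H →L[ℂ] H}
    (hY : ∀ x, 0 ≤ (inner ℂ x (Y x)).re) (t : ℝ) (ht : 0 ≤ t) (x : H) :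
    ‖NormedSpace.exp (t • (-Y)) x‖ ≤ ‖x‖ := by
  have hd : ∀ s : ℝ, HasDerivAt (fun s : ℝ => NormedSpace.exp (s • (-Y)) x)
      (-Y (NormedSpace.exp (s • (-Y)) x)) s := by
    intro s
    exact ((ContinuousLinearMap.apply ℂ H x).restrictScalars ℝ).hasFDerivAt.comp_hasDerivAt s
      (hasDerivAt_exp_smul_const' (𝕂 := ℝ) (-Y) s)
  have := norm_sq_le_exp_mul_of_re_inner_deriv_le (ω := 0) (b := t)
    (u := fun s => NormedSpace.exp (s • (-Y)) x)
    (fun s _ => (hd s).continuousAt.continuousWithinAt)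
    (fun s _ => (hd s).hasDerivWithinAt)
    (fun s _ => by simpa using hY _) t ⟨ht, le_rfl⟩
  exact (pow_le_pow_iff_left₀ (norm_nonneg _) (norm_nonneg _) two_ne_zero).1 (by simpa using this)

/-- A densely defined `m`-accretive operator, given by its graph. -/
structure IsMAccretive (A : Submodule ℂ (H × H)) : Prop where
  accretive : ∀ x y : H, (x, y) ∈ A → 0 ≤ (inner ℂ x y).re
  surj : ∀ r : ℝ, 0 < r → ∀ y : H, ∃ x, (x, r • (y - x)) ∈ A
  dense : Dense {x | ∃ y, (x, y) ∈ A}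

variable {A : Submodule ℂ (H × H)}

/-- The membership says x = (1 + r⁻¹A)⁻¹y. Accretivity gives ‖x‖² ≤ Re(y ∣ x) ≤ ‖x‖‖y‖. -/
theorem IsMAccretive.norm_le (hA : IsMAccretive A) {r : ℝ} (hr : 0 < r) {x y : H}
    (h : (x, r • (y - x)) ∈ A) : ‖x‖ ≤ ‖y‖ := by
  have h1 := hA.accretive _ _ h
  have h2 : inner ℂ x (r • (y - x)) = r * inner ℂ x (y - x) := by
    rw [← Complex.coe_smul, inner_smul_right]
  rw [h2, Complex.re_ofReal_mul, mul_nonneg_iff_of_pos_left hr, inner_sub_right,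
    Complex.sub_re] at h1
  have h3 : (inner ℂ x y).re ≤ ‖x‖ * ‖y‖ := re_inner_le_norm (𝕜 := ℂ) x y
  have h4 : (inner ℂ x x).re = ‖x‖ ^ 2 := inner_self_eq_norm_sq (𝕜 := ℂ) x
  by_contra! h5
  nlinarith [norm_nonneg y]

theorem IsMAccretive.unique (hA : IsMAccretive A) {r : ℝ} (hr : 0 < r) {x x' y : H}
    (h : (x, r • (y - x)) ∈ A) (h' : (x', r • (y - x')) ∈ A) : x = x' := by
  have h1 := A.sub_mem h h'
  have h2 : ((x, r • (y - x)) - (x', r • (y - x')) : H × H) = (x - x', r • (0 - (x - x'))) := by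
    ext <;> simp [← smul_sub]
  rw [h2] at h1
  have := hA.norm_le hr h1
  simpa [sub_eq_zero] using this

/-- `J = (1 + r⁻¹ A)⁻¹` and the Yosida approximation `Y = A J` of `A`. -/
structure IsYosida (A : Submodule ℂ (H × H)) (r : ℝ) (J Y : H →L[ℂ] H) : Prop where
  norm_le : ∀ x, ‖J x‖ ≤ ‖x‖
  mem : ∀ x, (J x, Y x) ∈ A
  eq : ∀ x, Y x = r • (x - J x)

theorem IsMAccretive.exists_yosida (hA : IsMAccretive A) {r : ℝ} (hr : 0 < r) :
    ∃ J Y : H →L[ℂ] H, IsYosida A r J Y := by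
  choose f hf using hA.surj r hr
  let J : H →L[ℂ] H := LinearMap.mkContinuous
    { toFun := f
      map_add' := fun x y => hA.unique hr (hf _) (by
        convert A.add_mem (hf x) (hf y) using 1
        rw [Prod.mk_add_mk, ← smul_add]; congr 2; abel)
      map_smul' := fun c x => hA.unique hr (hf _) (by
        convert A.smul_mem c (hf x) using 1
        rw [Prod.smul_mk, smul_comm c r, smul_sub c]; rfl) } 1
    (fun x => by simpa using hA.norm_le hr (hf x))
  refine ⟨J, r • (ContinuousLinearMap.id ℂ H - J), fun x => hA.norm_le hr (hf x), hf,
    fun x => rfl⟩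

end Accretive

/-! ### Yosida approximation and the generation theorem -/

section Yosida

variable {H : Type*} [NormedAddCommGroup H] [InnerProductSpace ℂ H] {A : Submodule ℂ (H × H)}

namespace IsYosida

variable {r s : ℝ} {J Y J' Y' : H →L[ℂ] H}

/-- Since x = Jx + r⁻¹Yx and Yx = A(Jx), Re(x ∣ Yx) splits into an accretive term at Jx and
r⁻¹‖Yx‖². -/
theorem accretive (hA : IsMAccretive A) (hr : 0 < r) (h : IsYosida A r J Y) (x : H) :
    0 ≤ (inner ℂ x (Y x)).re := by
  have h1 := hA.accretive _ _ (h.mem x)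
  have h2 : inner ℂ (Y x) (Y x) = r * inner ℂ (x - J x) (Y x) := by
    have : Y x = (r : ℂ) • (x - J x) := h.eq x
    nth_rewrite 1 [this]
    rw [inner_smul_left, Complex.conj_ofReal]
  have h3 : (inner ℂ (Y x) (Y x)).re = ‖Y x‖ ^ 2 := inner_self_eq_norm_sq (𝕜 := ℂ) (Y x)
  rw [h2, Complex.re_ofReal_mul] at h3
  have h4 : 0 ≤ (inner ℂ (x - J x) (Y x)).re :=
    (mul_nonneg_iff_of_pos_left hr).1 (h3 ▸ sq_nonneg _)
  rw [inner_sub_left, Complex.sub_re] at h4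
  linarith

theorem apply_eq_of_mem (hA : IsMAccretive A) (hr : 0 < r) (h : IsYosida A r J Y) {x y : H}
    (hxy : (x, y) ∈ A) : Y x = J y := by
  refine hA.unique hr (y := y) ?_ (h.eq y ▸ h.mem y)
  -- As r(x − Jx) = Yx, scaling the difference of the pairs by r gives (Yx, r(y − Yx)) ∈ A, the
  -- equation that characterises Jy.
  have h1 := A.smul_mem (r : ℂ) (A.sub_mem hxy (h.mem x))
  convert h1 using 1
  simp [h.eq x]

/-- `J` commutes with A on its domain, so J(J'x) solves the resolvent equation defining J'(Jx);
uniqueness identifies them. `Y` and `Y'` are affine in `J` and `J'`. -/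
theorem commute (hA : IsMAccretive A) (hs : 0 < s) (h : IsYosida A r J Y)
    (h' : IsYosida A s J' Y') (hr : 0 < r) : Commute Y Y' := by
  have hJ : Commute J J' := by
    ext x
    change J (J' x) = J' (J x)
    refine hA.unique hs (y := J x) ?_ (h'.eq (J x) ▸ h'.mem (J x))
    have h1 := h.apply_eq_of_mem hA hr (h'.mem x)
    have h2 := h.mem (J' x)
    rw [h1, h'.eq x] at h2
    have h3 : J (s • (x - J' x)) = s • (J x - J (J' x)) := by
      rw [← map_sub]; exact J.map_smul_of_tower _ _
    rwa [h3] at h2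
  have hY : Y = r • (1 - J) := by ext x; exact h.eq x
  have hY' : Y' = s • (1 - J') := by ext x; exact h'.eq x
  rw [hY, hY']
  exact (((Commute.one_left _).sub_left ((Commute.one_right _).sub_right hJ)).smul_left _
    ).smul_right _

theorem norm_sub_le (hA : IsMAccretive A) (hr : 0 < r) (h : IsYosida A r J Y) {x y : H}
    (hxy : (x, y) ∈ A) : ‖J x - x‖ ≤ r⁻¹ * ‖y‖ := by
  have h1 : x - J x = r⁻¹ • Y x := by rw [h.eq, inv_smul_smul₀ hr.ne']
  rw [norm_sub_rev, h1, norm_smul, h.apply_eq_of_mem hA hr hxy, norm_inv, Real.norm_of_nonneg hr.le]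
  gcongr
  exact h.norm_le y

end IsYosida

/-- Lumer–Phillips: the negative of an `m`-accretive operator on a Hilbert space generates a
`C₀`-semigroup. -/
theorem IsMAccretive.exists_semigroup [CompleteSpace H] (hA : IsMAccretive A) :
    ∃ T : ℝ≥0 → H →L[ℂ] H, IsC0Semigroup T ∧
      ∀ x h : H, InGeneratorGraph T x (-h) ↔ (x, h) ∈ A := by
  have hr : ∀ n : ℕ, (0 : ℝ) < n + 1 := fun n => by positivity
  have hex : ∀ n : ℕ, ∃ J Y : H →L[ℂ] H, IsYosida A (n + 1) J Y := fun n =>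
    hA.exists_yosida (hr n)
  choose J Y hY using hex
  have hJlim : ∀ x, Tendsto (fun n => J n x) atTop (𝓝 x) := by
    refine tendsto_of_dense_of_norm_le (S := ContinuousLinearMap.id ℂ H)
      (Eventually.of_forall fun n => (hY n).norm_le) (fun x => le_rfl) hA.dense ?_
    rintro x ⟨y, hxy⟩
    rw [ContinuousLinearMap.id_apply, tendsto_iff_norm_sub_tendsto_zero]
    refine squeeze_zero (fun _ => norm_nonneg _)
      (fun n => (hY n).norm_sub_le hA (hr n) hxy) ?_
    simpa using (tendsto_one_div_add_atTop_nhds_zero_nat (𝕜 := ℝ)).mul_const ‖y‖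
  have hYlim : ∀ x y, (x, y) ∈ A → Tendsto (fun n => Y n x) atTop (𝓝 y) := by
    intro x y hxy
    simpa only [(hY _).apply_eq_of_mem hA (hr _) hxy] using hJlim y
  let E : ℕ → ℝ≥0 → H →L[ℂ] H := fun n t => NormedSpace.exp ((t : ℝ) • (-Y n))
  have hYc : ∀ n (t : ℝ), 0 ≤ t → ∀ x, ‖NormedSpace.exp (t • (-Y n)) x‖ ≤ ‖x‖ := fun n =>
    norm_exp_neg_le_of_accretive ((hY n).accretive hA (hr n))
  have hE : ∀ n t x, ‖E n t x‖ ≤ ‖x‖ := fun n t => hYc n t t.2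
  have hE0 : ∀ n, E n 0 = 1 := fun n => by simp [E]
  have hEadd : ∀ n s t x, E n (s + t) x = E n s (E n t x) := by
    intro n s t x
    have hc : Commute ((s : ℝ) • (-Y n)) ((t : ℝ) • (-Y n)) :=
      ((Commute.refl _).smul_left _).smul_right _
    have : E n (s + t) = E n s * E n t := by
      let +nondep : NormedAlgebra ℚ (H →L[ℂ] H) := .restrictScalars ℚ ℂ _
      simp only [E]
      rw [← NormedSpace.exp_add_of_commute hc, ← add_smul]; rfl
    rw [this]; rfl
  have hEsub : ∀ n m (t : ℝ≥0) x, ‖E n t x - E m t x‖ ≤ t * ‖Y n x - Y m x‖ := by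
    intro n m t x
    have := norm_exp_sub_exp_le
      (((hY n).commute hA (hr m) (hY m) (hr n)).neg_left.neg_right) (hYc n) (hYc m) t.2 x
    refine this.trans_eq ?_
    have : (-Y n) x - (-Y m) x = -(Y n x - Y m x) := by simp; abel
    rw [this, norm_neg]; rfl
  have hEder : ∀ n x, InGeneratorGraph (E n) x (-Y n x) := by
    intro n x
    have h1 := ((ContinuousLinearMap.apply ℂ H x).restrictScalars ℝ).hasFDerivAt.comp_hasDerivAt
      (0 : ℝ) (hasDerivAt_exp_smul_const' (𝕂 := ℝ) (-Y n) 0)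
    have h2 := (hasDerivAt_iff_tendsto_slope.1 h1).mono_left
      (nhdsWithin_mono 0 (fun t (ht : 0 < t) => ne_of_gt ht))
    have h3 : Tendsto (fun t : ℝ≥0 => (t : ℝ)) (𝓝[>] 0) (𝓝[>] 0) := by
      refine tendsto_nhdsWithin_iff.2 ⟨?_, ?_⟩
      · exact (NNReal.continuous_coe.tendsto 0).mono_left nhdsWithin_le_nhds
      · filter_upwards [self_mem_nhdsWithin] with t ht
        exact ht
    have h4 := h2.comp h3
    simp only [zero_smul, NormedSpace.exp_zero, mul_one] at h4
    refine Tendsto.congr (fun t => ?_) h4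
    simp [slope, E]
  -- On the domain, `hEsub` bounds differences of the exponentials by those of the convergent
  -- sequence Yₙx; contractivity then covers all of `H`.
  have hT : ∀ t, ∃ S : H →L[ℂ] H, (∀ x, ‖S x‖ ≤ ‖x‖) ∧
      ∀ x, Tendsto (fun n => E n t x) atTop (𝓝 (S x)) := by
    intro t
    refine exists_tendsto_of_dense_of_norm_le (fun n => hE n t) hA.dense ?_
    rintro x ⟨y, hxy⟩
    have hc := ((hYlim x y hxy).const_smul (t : ℝ)).cauchySeq
    rw [Metric.cauchySeq_iff] at hc ⊢
    intro ε hε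
    obtain ⟨N, hN⟩ := hc ε hε
    refine ⟨N, fun m hm n hn => ?_⟩
    have := hN m hm n hn
    rw [dist_eq_norm] at this ⊢
    rw [← smul_sub, norm_smul, Real.norm_of_nonneg t.coe_nonneg] at this
    exact (hEsub m n t x).trans_lt this
  choose T hTn hTlim using hT
  have hTsub : ∀ m (t : ℝ≥0) x y, (x, y) ∈ A → ‖T t x - E m t x‖ ≤ t * ‖y - Y m x‖ := by
    intro m t x y hxy
    exact le_of_tendsto_of_tendsto' ((hTlim t x).sub_const _).norm
      (((hYlim x y hxy).sub_const _).norm.const_mul _) (fun n => hEsub n m t x)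
  have hTgen : ∀ x y, (x, y) ∈ A → InGeneratorGraph T x (-y) := by
    intro x y hxy
    rw [InGeneratorGraph, Metric.tendsto_nhds]
    intro ε hε
    -- `m` is fixed before t: by `hTsub` the difference quotients of T and Eₘ differ by at most ‖Yₘx
    -- − y‖, uniformly in t.
    obtain ⟨m, hm⟩ := ((Metric.tendsto_nhds.1 (hYlim x y hxy)) (ε / 3) (by positivity)).exists
    rw [dist_eq_norm] at hm
    filter_upwards [Metric.tendsto_nhds.1 (hEder m x) (ε / 3) (by positivity),
      self_mem_nhdsWithin] with t ht ht0
    have ht0 : (0 : ℝ) < t := ht0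
    rw [dist_eq_norm] at ht ⊢
    have h1 : ‖(t : ℝ)⁻¹ • (T t x - E m t x)‖ ≤ ‖Y m x - y‖ := by
      rw [norm_smul, norm_inv, Real.norm_of_nonneg ht0.le, inv_mul_le_iff₀ ht0,
        norm_sub_rev (Y m x)]
      exact hTsub m t x y hxy
    have h2 : (t : ℝ)⁻¹ • (T t x - x) - -y = (t : ℝ)⁻¹ • (T t x - E m t x) +
        ((t : ℝ)⁻¹ • (E m t x - x) - -Y m x) - (Y m x - y) := by
      rw [smul_sub, smul_sub, smul_sub]; abel
    rw [h2]
    have h3 := _root_.norm_sub_le ((t : ℝ)⁻¹ • (T t x - E m t x) +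
      ((t : ℝ)⁻¹ • (E m t x - x) - -Y m x)) (Y m x - y)
    have h4 := norm_add_le ((t : ℝ)⁻¹ • (T t x - E m t x))
      ((t : ℝ)⁻¹ • (E m t x - x) - -Y m x)
    linarith
  have hC0 : IsC0Semigroup T := by
    refine ⟨?_, ?_, ?_⟩
    · ext x
      refine tendsto_nhds_unique (hTlim 0 x) ?_
      simp [hE0]
    · intro s t
      ext x
      refine tendsto_nhds_unique (hTlim (s + t) x) ?_
      rw [ContinuousLinearMap.comp_apply]
      have h1 : Tendsto (fun n => E n s (E n t x - T t x)) atTop (𝓝 0) := by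
        refine squeeze_zero_norm (fun n => hE n s _) ?_
        exact tendsto_iff_norm_sub_tendsto_zero.1 (hTlim t x)
      have h2 := h1.add (hTlim s (T t x))
      simpa [hEadd] using h2
    · refine tendsto_of_dense_of_norm_le (S := ContinuousLinearMap.id ℂ H)
        (Eventually.of_forall hTn) (fun x => le_rfl) hA.dense ?_
      rintro x ⟨y, hxy⟩
      have h1 : Tendsto (fun t : ℝ≥0 => (t : ℝ)) (𝓝[>] 0) (𝓝 0) :=
        (NNReal.continuous_coe.tendsto 0).mono_left nhdsWithin_le_nhds
      have h2 := (h1.smul (hTgen x y hxy)).add_const x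
      rw [zero_smul, zero_add] at h2
      refine h2.congr' ?_
      filter_upwards [self_mem_nhdsWithin] with t ht
      have ht : (t : ℝ) ≠ 0 := ne_of_gt (NNReal.coe_pos.2 ht)
      rw [smul_inv_smul₀ ht, sub_add_cancel]
  refine ⟨T, hC0, fun x h => ⟨fun hx => ?_, hTgen x h⟩⟩
  -- The generator has no larger domain: choose y in D(A) with y + Ay = x + h. Then the generator
  -- sends x − y to itself, while contractivity makes it dissipative, so x = y.
  obtain ⟨y, hy⟩ := hA.surj 1 one_pos (x + h)
  rw [one_smul] at hy
  have h1 := hx.sub (hTgen _ _ hy)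
  have h2 : -h - -(x + h - y) = x - y := by abel
  rw [h2] at h1
  have h3 : (inner ℂ (x - y) (x - y)).re ≤ 0 := by
    have h4 := (Complex.continuous_re.tendsto _).comp (((innerSL ℂ (x - y)).continuous.tendsto _).comp h1)
    refine le_of_tendsto h4 (Eventually.of_forall fun t => ?_)
    simp only [Function.comp, innerSL_apply_apply]
    rw [← Complex.coe_smul, inner_smul_right, Complex.re_ofReal_mul, inner_sub_right,
      Complex.sub_re]
    refine mul_nonpos_of_nonneg_of_nonpos (by positivity) ?_
    have h5 : (inner ℂ (x - y) (T t (x - y))).re ≤ ‖x - y‖ * ‖T t (x - y)‖ :=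
      re_inner_le_norm (𝕜 := ℂ) _ _
    have h6 : (inner ℂ (x - y) (x - y)).re = ‖x - y‖ ^ 2 :=
      inner_self_eq_norm_sq (𝕜 := ℂ) _
    have h7 := hTn t (x - y)
    nlinarith [norm_nonneg (x - y)]
  have h4 : (inner ℂ (x - y) (x - y)).re = ‖x - y‖ ^ 2 := inner_self_eq_norm_sq (𝕜 := ℂ) _
  have h5 : ‖x - y‖ = 0 := by
    rw [h4] at h3
    exact pow_eq_zero_iff two_ne_zero |>.1 (le_antisymm h3 (sq_nonneg _))
  obtain rfl : x = y := by rwa [norm_eq_zero, sub_eq_zero] at h5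
  simpa using hy

end Yosida

/-! ### Exponential rescaling of semigroups -/

section Rescaling

variable {H : Type*} [NormedAddCommGroup H] [NormedSpace ℂ H] {T : ℝ≥0 → H →L[ℂ] H}

theorem tendsto_exp_mul_coe_nhdsGT_zero (c : ℝ) :
    Tendsto (fun t : ℝ≥0 => Real.exp (c * t)) (𝓝[>] 0) (𝓝 1) := by
  have h : Continuous fun t : ℝ≥0 => Real.exp (c * t) := by fun_prop
  simpa using (h.tendsto 0).mono_left nhdsWithin_le_nhds

theorem IsC0Semigroup.rescale (hT : IsC0Semigroup T) (c : ℝ) :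
    IsC0Semigroup fun t => Real.exp (c * t) • T t := by
  refine ⟨by simp [hT.zero], fun s t => ?_, fun x => ?_⟩
  · ext x
    simp only [smul_apply, ContinuousLinearMap.comp_apply, hT.add_apply]
    rw [(T s).map_smul_of_tower, smul_smul, ← Real.exp_add]
    congr 2
    push_cast; ring
  · simpa using (tendsto_exp_mul_coe_nhdsGT_zero c).smul (hT.tendsto x)

theorem InGeneratorGraph.rescale {x y : H} (h : InGeneratorGraph T x y) (c : ℝ) :
    InGeneratorGraph (fun t => Real.exp (c * t) • T t) x (y + c • x) := by
  have h1 : Tendsto (fun t : ℝ≥0 => (t : ℝ)⁻¹ * (Real.exp (c * t) - 1)) (𝓝[>] 0) (𝓝 c) := by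
    have hd : HasDerivAt (fun t : ℝ => Real.exp (c * t)) c 0 := by
      simpa using ((hasDerivAt_id (0 : ℝ)).const_mul c).exp
    have h2 := (hasDerivAt_iff_tendsto_slope.1 hd).mono_left
      (nhdsWithin_mono 0 (fun t (ht : 0 < t) => ne_of_gt ht))
    have h3 : Tendsto (fun t : ℝ≥0 => (t : ℝ)) (𝓝[>] 0) (𝓝[>] 0) := by
      refine tendsto_nhdsWithin_iff.2 ⟨?_, ?_⟩
      · exact (NNReal.continuous_coe.tendsto 0).mono_left nhdsWithin_le_nhds
      · filter_upwards [self_mem_nhdsWithin] with t ht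
        exact ht
    refine (h2.comp h3).congr fun t => ?_
    simp [slope]
  have h2 := ((tendsto_exp_mul_coe_nhdsGT_zero c).smul h).add (h1.smul_const x)
  rw [one_smul] at h2
  refine h2.congr fun t => ?_
  simp only [smul_apply]
  module

theorem inGeneratorGraph_rescale_iff {x y : H} (c : ℝ) :
    InGeneratorGraph (fun t => Real.exp (c * t) • T t) x y ↔
      InGeneratorGraph T x (y - c • x) := by
  refine ⟨fun h => ?_, fun h => by simpa using h.rescale c⟩
  have := h.rescale (-c)
  rw [neg_smul, ← sub_eq_add_neg] at this
  convert this using 2 with t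
  rw [smul_smul, ← Real.exp_add]; simp

end Rescaling

/-! ### Shifted forms and shifted operators -/

section Shift

variable {V H : Type*} [NormedAddCommGroup V] [InnerProductSpace ℂ V]
  [NormedAddCommGroup H] [InnerProductSpace ℂ H]

/-- The form `a(u,v) + c (u ∣ v)_H`. -/
noncomputable def shiftForm (j : V →L[ℂ] H) (a : V →ₗ[ℂ] V →ₗ⋆[ℂ] ℂ) (c : ℝ) :
    V →ₗ[ℂ] V →ₗ⋆[ℂ] ℂ :=
  LinearMap.mk₂'ₛₗ (RingHom.id ℂ) (starRingEnd ℂ)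
    (fun u v => a u v + c * inner ℂ (j v) (j u))
    (fun u u' v => by simp; ring)
    (fun c u v => by simp; ring)
    (fun u v v' => by simp; ring)
    (fun c u v => by simp; ring)

theorem shiftForm_apply (j : V →L[ℂ] H) (a : V →ₗ[ℂ] V →ₗ⋆[ℂ] ℂ) (c : ℝ) (u v : V) :
    shiftForm j a c u v = a u v + c * inner ℂ (j v) (j u) := rfl

theorem IsContinuousForm.shiftForm {a : V →ₗ[ℂ] V →ₗ⋆[ℂ] ℂ} (ha : IsContinuousForm a)
    (j : V →L[ℂ] H) (c : ℝ) : IsContinuousForm (shiftForm j a c) := by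
  obtain ⟨M, hM⟩ := ha
  refine ⟨M + |c| * (‖j‖ * ‖j‖), fun u v => ?_⟩
  rw [shiftForm_apply]
  refine (norm_add_le _ _).trans ?_
  rw [norm_mul, Complex.norm_real, Real.norm_eq_abs]
  have h1 : ‖inner ℂ (j v) (j u)‖ ≤ (‖j‖ * ‖v‖) * (‖j‖ * ‖u‖) :=
    (norm_inner_le_norm _ _).trans (mul_le_mul (j.le_opNorm _) (j.le_opNorm _) (norm_nonneg _)
      (by positivity))
  have h2 := mul_le_mul_of_nonneg_left h1 (abs_nonneg c)
  have h3 := hM u v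
  linarith

theorem shiftForm_self_re (j : V →L[ℂ] H) (a : V →ₗ[ℂ] V →ₗ⋆[ℂ] ℂ) (c : ℝ) (u : V) :
    (shiftForm j a c u u).re = (a u u).re + c * ‖j u‖ ^ 2 := by
  have h : (inner ℂ (j u) (j u)).re = ‖j u‖ ^ 2 := inner_self_eq_norm_sq (𝕜 := ℂ) _
  rw [shiftForm_apply, Complex.add_re, Complex.re_ofReal_mul, h]

/-- The graph of `A + ω`, where `A` is the operator associated with `a`. -/
def operatorGraph (j : V →L[ℂ] H) (a : V →ₗ[ℂ] V →ₗ⋆[ℂ] ℂ) (ω : ℝ) : Submodule ℂ (H × H) where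
  carrier := {p | InOperatorGraph j a p.1 (p.2 - (ω : ℂ) • p.1)}
  zero_mem' := ⟨0, by simp⟩
  add_mem' := by
    rintro ⟨x, h⟩ ⟨x', h'⟩ ⟨f, hf, hfg⟩ ⟨f', hf', hfg'⟩
    refine ⟨f + f', by simp [hf, hf'], fun g => ?_⟩
    rw [map_add, LinearMap.add_apply, hfg, hfg', ← inner_add_right]
    congr 1
    simp only [Prod.fst_add, Prod.snd_add]
    module
  smul_mem' := by
    rintro c ⟨x, h⟩ ⟨f, hf, hfg⟩
    refine ⟨c • f, by simp [hf], fun g => ?_⟩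
    rw [map_smul, LinearMap.smul_apply, hfg, smul_eq_mul, ← inner_smul_right]
    congr 1
    simp only [Prod.smul_fst, Prod.smul_snd]
    module

theorem mem_operatorGraph {j : V →L[ℂ] H} {a : V →ₗ[ℂ] V →ₗ⋆[ℂ] ℂ} {ω : ℝ} {x h : H} :
    (x, h) ∈ operatorGraph j a ω ↔ InOperatorGraph j a x (h - (ω : ℂ) • x) := Iff.rfl

end Shift

/-! ### Lax–Milgram and the semigroup of an elliptic form -/

section LaxMilgram

variable {V H : Type*} [NormedAddCommGroup V] [InnerProductSpace ℂ V] [CompleteSpace V]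
  [NormedAddCommGroup H] [InnerProductSpace ℂ H]

theorem IsContinuousForm.exists_operator {a : V →ₗ[ℂ] V →ₗ⋆[ℂ] ℂ} (ha : IsContinuousForm a) :
    ∃ L : V →L[ℂ] V, ∀ f g, inner ℂ g (L f) = a f g := by
  obtain ⟨M, hM⟩ := ha
  -- Conjugating the values swaps linearity and antilinearity, which suits the Riesz representation.
  let B : V →ₗ⋆[ℂ] V →ₗ[ℂ] ℂ := LinearMap.mk₂'ₛₗ (starRingEnd ℂ) (RingHom.id ℂ)
    (fun f g => starRingEnd ℂ (a f g)) (by simp) (by simp) (by simp) (by simp)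
  let B' : V →L⋆[ℂ] V →L[ℂ] ℂ := B.mkContinuous₂ M (fun f g => by simpa [B] using hM f g)
  refine ⟨InnerProductSpace.continuousLinearMapOfBilin B', fun f g => ?_⟩
  rw [← inner_conj_symm, InnerProductSpace.continuousLinearMapOfBilin_apply]
  simp [B', B]

/-- The Lax–Milgram theorem for sesquilinear forms. -/
theorem IsContinuousForm.exists_equiv {a : V →ₗ[ℂ] V →ₗ⋆[ℂ] ℂ} (ha : IsContinuousForm a) {α : ℝ}
    (hα : 0 < α) (hcoer : ∀ u, α * ‖u‖ ^ 2 ≤ (a u u).re) :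
    ∃ L : V ≃L[ℂ] V, ∀ f g, inner ℂ g (L f) = a f g := by
  obtain ⟨L, hL⟩ := ha.exists_operator
  have hbelow : ∀ u, α * ‖u‖ ≤ ‖L u‖ := by
    intro u
    have h1 := hcoer u
    rw [← hL] at h1
    have h2 : (inner ℂ u (L u)).re ≤ ‖u‖ * ‖L u‖ := re_inner_le_norm (𝕜 := ℂ) _ _
    by_contra! h3
    have h4 : 0 < ‖u‖ := by
      by_contra h5
      have : u = 0 := norm_eq_zero.1 (le_antisymm (not_lt.1 h5) (norm_nonneg _))
      simp [this] at h3
    nlinarith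
  have hanti : AntilipschitzWith (α⁻¹).toNNReal L := by
    refine ContinuousLinearMap.antilipschitz_of_bound L fun u => ?_
    rw [Real.coe_toNNReal _ (inv_nonneg.2 hα.le), ← div_eq_inv_mul, le_div_iff₀ hα, mul_comm]
    exact hbelow u
  -- Being bounded below, `L` has closed range; a vector w orthogonal to it has a(w,w) = 0, so
  -- coercivity gives w = 0.
  have hrange : L.range = ⊤ := by
    have hcl : IsClosed (L.range : Set V) := hanti.isClosed_range L.uniformContinuous
    have := hcl.completeSpace_coe
    rw [← L.range.orthogonal_orthogonal, Submodule.eq_top_iff']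
    intro v w hw
    have h1 : inner ℂ (L w) w = 0 := hw _ ⟨w, rfl⟩
    have h2 := hcoer w
    rw [← hL, inner_eq_zero_symm.1 h1, Complex.zero_re] at h2
    have h3 : ‖w‖ ^ 2 = 0 := le_antisymm (by nlinarith) (sq_nonneg _)
    have h4 : w = 0 := by simpa using h3
    simp [h4]
  exact ⟨ContinuousLinearEquiv.ofBijective L (LinearMap.ker_eq_bot.2 hanti.injective) hrange, hL⟩

variable [CompleteSpace H]

/-- The orthogonal complement of the range of the adjoint is the kernel of `j`. -/
theorem denseRange_adjoint {j : V →L[ℂ] H} (hj : Function.Injective j) :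
    DenseRange (ContinuousLinearMap.adjoint j) := by
  have h : Dense ((ContinuousLinearMap.adjoint j).range : Set V) := by
    rw [Submodule.dense_iff_topologicalClosure_eq_top, Submodule.topologicalClosure_eq_top_iff,
      Submodule.eq_bot_iff]
    intro v hv
    refine hj ?_
    rw [map_zero, ← inner_self_eq_zero (𝕜 := ℂ), ← ContinuousLinearMap.adjoint_inner_left]
    exact hv _ ⟨_, rfl⟩
  exact h

variable {j : V →L[ℂ] H} {a : V →ₗ[ℂ] V →ₗ⋆[ℂ] ℂ}

/-- Lax–Milgram for the shifted form, with (y ∣ jg) in `H` rewritten as (j*y ∣ g) in `V`. Writing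
the solution as L(j*y) with `L` an isomorphism of `V` also makes the set of solutions dense in `V`.
-/
theorem IsElliptic.exists_solution (ha : IsContinuousForm a) {α ω : ℝ}
    (hα : 0 < α) (hell : ∀ u, α * ‖u‖ ^ 2 - ω * ‖j u‖ ^ 2 ≤ (a u u).re) {r : ℝ} (hr : ω ≤ r) :
    ∃ L : V ≃L[ℂ] V, ∀ y g, a (L (ContinuousLinearMap.adjoint j y)) g =
      inner ℂ (j g) (y - (r : ℂ) • j (L (ContinuousLinearMap.adjoint j y))) := by
  obtain ⟨L, hL⟩ := (ha.shiftForm j r).exists_equiv hα fun u => by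
    rw [shiftForm_self_re]
    nlinarith [hell u, mul_le_mul_of_nonneg_right hr (sq_nonneg ‖j u‖)]
  refine ⟨L.symm, fun y g => ?_⟩
  have := hL (L.symm (ContinuousLinearMap.adjoint j y)) g
  rw [L.apply_symm_apply, ContinuousLinearMap.adjoint_inner_right, shiftForm_apply] at this
  rw [inner_sub_right, this, inner_smul_right]
  ring

/-- The domain of the operator associated with an elliptic form is a form core. -/
theorem IsElliptic.dense_domain (hj : Function.Injective j) (ha : IsContinuousForm a)
    (hell : IsElliptic j a) : Dense {f : V | ∃ h : H, ∀ g, a f g = inner ℂ (j g) h} := by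
  obtain ⟨α, hα, ω, hell⟩ := hell
  obtain ⟨L, hL⟩ := IsElliptic.exists_solution ha hα hell le_rfl
  have h1 : DenseRange (L ∘ ContinuousLinearMap.adjoint j) :=
    L.surjective.denseRange.comp (denseRange_adjoint hj) L.continuous
  refine h1.mono ?_
  rintro _ ⟨y, rfl⟩
  exact ⟨_, hL y⟩

theorem IsElliptic.dense_operator_domain (hj : Function.Injective j) (hd : DenseRange j)
    (ha : IsContinuousForm a) (hell : IsElliptic j a) :
    Dense {x | ∃ h, InOperatorGraph j a x h} := by
  refine (hd.dense_image j.continuous (hell.dense_domain hj ha)).mono ?_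
  rintro _ ⟨f, ⟨h, hf⟩, rfl⟩
  exact ⟨h, f, rfl, hf⟩

theorem isMAccretive_operatorGraph (hj : Function.Injective j) (hd : DenseRange j)
    (ha : IsContinuousForm a) {α ω : ℝ} (hα : 0 < α)
    (hell : ∀ u, α * ‖u‖ ^ 2 - ω * ‖j u‖ ^ 2 ≤ (a u u).re) :
    IsMAccretive (operatorGraph j a ω) where
  accretive := by
    rintro x h ⟨f, rfl, hfg⟩
    have h1 := hell f
    have h2 : (inner ℂ (j f) (j f)).re = ‖j f‖ ^ 2 := inner_self_eq_norm_sq (𝕜 := ℂ) _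
    rw [hfg, inner_sub_right, inner_smul_right, Complex.sub_re, Complex.re_ofReal_mul, h2] at h1
    have h3 : 0 ≤ α * ‖f‖ ^ 2 := by positivity
    linarith
  surj := by
    intro r hr y
    -- (A + ω)x = r(y − x) is the same as (A + ω + r)x = ry.
    obtain ⟨L, hL⟩ := IsElliptic.exists_solution ha hα hell (r := ω + r) (by linarith)
    refine ⟨j (L (ContinuousLinearMap.adjoint j ((r : ℂ) • y))), _, rfl, fun g => ?_⟩
    rw [hL, ← Complex.coe_smul]
    congr 1
    push_cast
    module
  dense := by
    refine (IsElliptic.dense_operator_domain hj hd ha ⟨α, hα, ω, hell⟩).mono ?_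
    rintro x ⟨h, hx⟩
    exact ⟨h + (ω : ℂ) • x, by rwa [mem_operatorGraph, add_sub_cancel_right]⟩

theorem IsSemigroupOfForm.unique (hj : Function.Injective j) (hd : DenseRange j)
    (ha : IsContinuousForm a) (hell : IsElliptic j a) {T T' : ℝ≥0 → H →L[ℂ] H}
    (hT : IsSemigroupOfForm j a T) (hT' : IsSemigroupOfForm j a T') : T = T' := by
  have hdense := hell.dense_operator_domain hj hd ha
  obtain ⟨α, hα, ω, hell⟩ := hell
  refine hT.1.eq_of_generator hT'.1 (G := fun x y => InOperatorGraph j a x (-y)) (ω := ω)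
    (fun x y => by simpa using hT.2 x (-y)) (fun x y => by simpa using hT'.2 x (-y)) ?_
    (hdense.mono (by rintro x ⟨h, hx⟩; exact ⟨-h, by simpa using hx⟩))
  rintro x y ⟨f, rfl, hfg⟩
  have h1 := hell f
  rw [hfg, inner_neg_right, Complex.neg_re] at h1
  have h3 : 0 ≤ α * ‖f‖ ^ 2 := by positivity
  linarith

theorem IsElliptic.existsUnique_semigroup (hj : Function.Injective j) (hd : DenseRange j)
    (ha : IsContinuousForm a) (hell : IsElliptic j a) :
    ∃! T : ℝ≥0 → H →L[ℂ] H, IsSemigroupOfForm j a T := by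
  obtain ⟨α, hα, ω, hell'⟩ := id hell
  obtain ⟨T, hT, hTA⟩ := (isMAccretive_operatorGraph hj hd ha hα hell').exists_semigroup
  have hform : IsSemigroupOfForm j a fun t => Real.exp (ω * t) • T t := by
    refine ⟨hT.rescale ω, fun x h => ?_⟩
    rw [inGeneratorGraph_rescale_iff, show -h - ω • x = -(h + ω • x) by abel, hTA,
      mem_operatorGraph, Complex.coe_smul, add_sub_cancel_right]
  exact ⟨_, hform, fun T' hT' => hT'.unique hj hd ha hell hform⟩

end LaxMilgram

/-! ### Conjugations -/

section Conjugation

/-- Antilinear involutions. -/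
structure IsConjugation {E : Type*} [AddCommGroup E] [Module ℂ E] (C : E → E) : Prop where
  add : ∀ x y, C (x + y) = C x + C y
  smul : ∀ (c : ℂ) x, C (c • x) = starRingEnd ℂ c • C x
  involutive : ∀ x, C (C x) = x

namespace IsConjugation

section Algebra

variable {E : Type*} [AddCommGroup E] [Module ℂ E] {C : E → E}

theorem zero (hC : IsConjugation C) : C 0 = 0 := by
  simpa using hC.smul 0 0

theorem real_smul (hC : IsConjugation C) (r : ℝ) (x : E) : C ((r : ℂ) • x) = (r : ℂ) • C x := by
  rw [hC.smul, Complex.conj_ofReal]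

theorem neg (hC : IsConjugation C) (x : E) : C (-x) = -C x := by
  simpa using hC.smul (-1) x

theorem sub (hC : IsConjugation C) (x y : E) : C (x - y) = C x - C y := by
  rw [sub_eq_add_neg, hC.add, hC.neg, sub_eq_add_neg]

theorem exists_decomposition (hC : IsConjugation C) (x : E) :
    ∃ p q, C p = p ∧ C q = q ∧ x = p + Complex.I • q ∧ C x = p - Complex.I • q := by
  refine ⟨(1 / 2 : ℂ) • (x + C x), (-Complex.I / 2) • (x - C x), ?_, ?_, ?_, ?_⟩
  · rw [hC.smul, hC.add, hC.involutive, add_comm, map_div₀, map_one, Complex.conj_ofNat]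
  · rw [hC.smul, hC.sub, hC.involutive]
    simp only [map_div₀, map_neg, Complex.conj_I, Complex.conj_ofNat]
    module
  · rw [smul_smul, show Complex.I * (-Complex.I / 2) = 1 / 2 by
      linear_combination (-1 / 2) * Complex.I_mul_I]
    module
  · rw [smul_smul, show Complex.I * (-Complex.I / 2) = 1 / 2 by
      linear_combination (-1 / 2) * Complex.I_mul_I]
    module

/-- A sesquilinear form that is real on fixed vectors intertwines the conjugations. -/
theorem map_form (hC : IsConjugation C) {a : E →ₗ[ℂ] E →ₗ⋆[ℂ] ℂ}
    (ha : ∀ p q, C p = p → C q = q → (a p q).im = 0) (x y : E) :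
    a (C x) (C y) = starRingEnd ℂ (a x y) := by
  obtain ⟨p, q, hp, hq, hx, hCx⟩ := hC.exists_decomposition x
  obtain ⟨p', q', hp', hq', hy, hCy⟩ := hC.exists_decomposition y
  have h1 := Complex.conj_eq_iff_im.2 (ha p p' hp hp')
  have h2 := Complex.conj_eq_iff_im.2 (ha p q' hp hq')
  have h3 := Complex.conj_eq_iff_im.2 (ha q p' hq hp')
  have h4 := Complex.conj_eq_iff_im.2 (ha q q' hq hq')
  rw [hCx, hCy, hx, hy]
  simp [h1, h2, h3, h4, sub_eq_add_neg]

/-- A linear map that preserves the space of fixed vectors of a conjugation commutes with it. -/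
theorem commute_of_fixed (hC : IsConjugation C) {L : E →ₗ[ℂ] E}
    (h : ∀ x, C x = x → C (L x) = L x) (x : E) : C (L x) = L (C x) := by
  obtain ⟨p, q, hp, hq, hx, hCx⟩ := hC.exists_decomposition x
  rw [hCx, hx, map_add, map_sub, map_smul, hC.add, hC.smul, h p hp, h q hq, Complex.conj_I]
  module

end Algebra

variable {E : Type*} [NormedAddCommGroup E] [InnerProductSpace ℂ E] {C : E → E}

theorem norm_map (hCi : ∀ x y, inner ℂ (C x) (C y) = inner ℂ y x) (x : E) : ‖C x‖ = ‖x‖ := by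
  rw [norm_eq_sqrt_re_inner (𝕜 := ℂ), norm_eq_sqrt_re_inner (𝕜 := ℂ), hCi]

theorem continuous (hC : IsConjugation C) (hCi : ∀ x y, inner ℂ (C x) (C y) = inner ℂ y x) :
    Continuous C := by
  have : Isometry C := Isometry.of_dist_eq fun x y => by
    rw [dist_eq_norm, dist_eq_norm, ← hC.sub, norm_map hCi]
  exact this.continuous

/-- The conjugate `C L C` of a bounded operator. -/
noncomputable def conjugate (hC : IsConjugation C)
    (hCi : ∀ x y, inner ℂ (C x) (C y) = inner ℂ y x) (L : E →L[ℂ] E) : E →L[ℂ] E where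
  toFun x := C (L (C x))
  map_add' x y := by simp [hC.add]
  map_smul' c x := by simp [hC.smul]
  cont := (hC.continuous hCi).comp (L.continuous.comp (hC.continuous hCi))

theorem conjugate_apply (hC : IsConjugation C)
    (hCi : ∀ x y, inner ℂ (C x) (C y) = inner ℂ y x) (L : E →L[ℂ] E) (x : E) :
    hC.conjugate hCi L x = C (L (C x)) := rfl

theorem isC0Semigroup (hC : IsConjugation C) (hCi : ∀ x y, inner ℂ (C x) (C y) = inner ℂ y x)
    {T : ℝ≥0 → E →L[ℂ] E} (hT : IsC0Semigroup T) :
    IsC0Semigroup fun t => hC.conjugate hCi (T t) := by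
  refine ⟨?_, fun s t => ?_, fun x => ?_⟩
  · ext x
    simp [conjugate_apply, hT.zero, hC.involutive]
  · ext x
    simp [conjugate_apply, hT.add, hC.involutive]
  · have := ((hC.continuous hCi).tendsto _).comp (hT.tendsto (C x))
    rwa [hC.involutive] at this

theorem inGeneratorGraph (hC : IsConjugation C)
    (hCi : ∀ x y, inner ℂ (C x) (C y) = inner ℂ y x) {T : ℝ≥0 → E →L[ℂ] E} {x y : E}
    (h : InGeneratorGraph T (C x) (C y)) :
    InGeneratorGraph (fun t => hC.conjugate hCi (T t)) x y := by
  have := ((hC.continuous hCi).tendsto _).comp h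
  rw [hC.involutive] at this
  refine this.congr fun t => ?_
  simp only [Function.comp, conjugate_apply]
  rw [← Complex.coe_smul, hC.real_smul, hC.sub, hC.involutive, Complex.coe_smul]

end IsConjugation

variable {V H : Type*} [NormedAddCommGroup V] [InnerProductSpace ℂ V]
  [NormedAddCommGroup H] [InnerProductSpace ℂ H]
  {j : V →L[ℂ] H} {a : V →ₗ[ℂ] V →ₗ⋆[ℂ] ℂ} {CV : V → V} {CH : H → H}

theorem IsConjugation.inOperatorGraph (hCV : IsConjugation CV)
    (hCHi : ∀ x y, inner ℂ (CH x) (CH y) = inner ℂ y x) (hCj : ∀ v, j (CV v) = CH (j v))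
    (haC : ∀ u v, a (CV u) (CV v) = starRingEnd ℂ (a u v)) {x h : H}
    (hx : InOperatorGraph j a x h) : InOperatorGraph j a (CH x) (CH h) := by
  obtain ⟨f, rfl, hf⟩ := hx
  refine ⟨CV f, hCj f, fun g => ?_⟩
  rw [← hCV.involutive g, haC, hf, hCj (CV g), hCHi, inner_conj_symm]

variable [CompleteSpace V] [CompleteSpace H]

/-- The semigroup of an elliptic form is real iff the form is. -/
theorem IsSemigroupOfForm.forall_fixed_iff (hj : Function.Injective j) (hd : DenseRange j)
    (ha : IsContinuousForm a) (hell : IsElliptic j a) {T : ℝ≥0 → H →L[ℂ] H}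
    (hT : IsSemigroupOfForm j a T) (hCV : IsConjugation CV) (hCH : IsConjugation CH)
    (hCVi : ∀ x y, inner ℂ (CV x) (CV y) = inner ℂ y x)
    (hCHi : ∀ x y, inner ℂ (CH x) (CH y) = inner ℂ y x) (hCj : ∀ v, j (CV v) = CH (j v)) :
    (∀ t x, CH x = x → CH (T t x) = T t x) ↔
      ∀ u v, a (CV u) (CV v) = starRingEnd ℂ (a u v) := by
  constructor
  · intro hfix
    -- Preserving fixed vectors amounts to commuting with the conjugation.
    have hcomm : (fun t => hCH.conjugate hCHi (T t)) = T := by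
      ext t x
      have := hCH.commute_of_fixed (L := (T t).toLinearMap) (hfix t) (CH x)
      rw [hCH.involutive] at this
      exact this
    have hgraph : ∀ x h, InOperatorGraph j a x h → InOperatorGraph j a (CH x) (CH h) := by
      intro x h hx
      rw [← hT.2, ← hcomm, ← hCH.neg]
      refine hCH.inGeneratorGraph hCHi ?_
      rw [hCH.involutive, hCH.involutive]
      exact (hT.2 x h).2 hx
    obtain ⟨L, hL⟩ := ha.exists_operator
    intro u v
    revert u
    rw [← funext_iff]
    have hcont : ∀ w, Continuous fun u => a u w := fun w => by
      simp only [← hL]; fun_prop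
    -- Density for the norm of `V`, not merely that of `H`, is needed here, since the form is
    -- continuous only on `V`.
    refine Continuous.ext_on (hell.dense_domain hj ha)
      ((hcont (CV v)).comp (hCV.continuous hCVi)) (Complex.continuous_conj.comp (hcont v)) ?_
    rintro f ⟨h, hf⟩
    obtain ⟨f', hf', hfg⟩ := hgraph (j f) h ⟨f, rfl, hf⟩
    rw [← hCj] at hf'
    obtain rfl := hj hf'
    simp only
    rw [hfg, hf, hCj, hCHi, inner_conj_symm]
  · intro haC
    have hT' : IsSemigroupOfForm j a fun t => hCH.conjugate hCHi (T t) := by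
      refine ⟨hCH.isC0Semigroup hCHi hT.1, fun x h => ⟨fun hx => ?_, fun hx => ?_⟩⟩
      · have h1 : InGeneratorGraph T (CH x) (-CH h) := by
          rw [← hCH.neg]
          refine Tendsto.congr (fun t => ?_) (((hCH.continuous hCHi).tendsto _).comp hx)
          simp only [Function.comp, IsConjugation.conjugate_apply]
          rw [← Complex.coe_smul, hCH.real_smul, hCH.sub, hCH.involutive, Complex.coe_smul]
        have h2 := hCV.inOperatorGraph hCHi hCj haC ((hT.2 _ _).1 h1)
        rwa [hCH.involutive, hCH.involutive] at h2
      · refine hCH.inGeneratorGraph hCHi ?_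
        rw [hCH.neg, hT.2]
        exact hCV.inOperatorGraph hCHi hCj haC hx
    have heq := hT'.unique hj hd ha hell hT
    intro t x hx
    have := congrArg (fun S => S t x) heq
    simpa [IsConjugation.conjugate_apply, hx] using this

end Conjugation

/-! ### The energy form -/

section Energy

variable {V H : Type*} [NormedAddCommGroup V] [InnerProductSpace ℂ V]
  [NormedAddCommGroup H] [InnerProductSpace ℂ H] {j : V →L[ℂ] H}
  {a b : V →ₗ[ℂ] V →ₗ⋆[ℂ] ℂ}

theorem energyForm_apply (u v : WithLp 2 (V × V)) :
    energyForm a b u v = -inner ℂ v.fst u.snd + a u.fst v.snd + b u.snd v.snd := rfl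

@[simp]
theorem energyEmbedding_fst (u : WithLp 2 (V × V)) : (energyEmbedding j u).fst = u.fst := rfl

@[simp]
theorem energyEmbedding_snd (u : WithLp 2 (V × V)) : (energyEmbedding j u).snd = j u.snd := rfl

theorem energyEmbedding_injective (hj : Function.Injective j) :
    Function.Injective (energyEmbedding j) := by
  intro u v huv
  refine WithLp.ofLp_injective 2 (Prod.ext ?_ (hj ?_))
  · simpa using congrArg (fun w => w.fst) huv
  · simpa using congrArg (fun w => w.snd) huv

theorem energyEmbedding_denseRange (hd : DenseRange j) : DenseRange (energyEmbedding j) := by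
  refine (WithLp.prodContinuousLinearEquiv 2 ℂ V H).symm.surjective.denseRange.comp ?_
    (WithLp.prodContinuousLinearEquiv 2 ℂ V H).symm.continuous
  exact (denseRange_id.prodMap hd).comp
    (WithLp.prodContinuousLinearEquiv 2 ℂ V V).surjective.denseRange
    (continuous_id.prodMap j.continuous)

theorem isContinuousForm_energyForm (ha : IsContinuousForm a) (hb : IsContinuousForm b) :
    IsContinuousForm (energyForm a b) := by
  obtain ⟨Ma, hMa⟩ := ha
  obtain ⟨Mb, hMb⟩ := hb
  have key : ∀ (M x y X Y : ℝ), 0 ≤ x → 0 ≤ y → x ≤ X → y ≤ Y → M * x * y ≤ |M| * (X * Y) := by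
    intro M x y X Y hx hy hX hY
    calc M * x * y = M * (x * y) := by ring
      _ ≤ |M| * (x * y) := by gcongr; exact le_abs_self M
      _ ≤ |M| * (X * Y) := by gcongr; exact hx.trans hX
  refine ⟨1 + |Ma| + |Mb|, fun u v => ?_⟩
  have hu1 : ‖u.fst‖ ≤ ‖u‖ := WithLp.norm_fst_le _ u
  have hu2 : ‖u.snd‖ ≤ ‖u‖ := WithLp.norm_snd_le _ u
  have hv1 : ‖v.fst‖ ≤ ‖v‖ := WithLp.norm_fst_le _ v
  have hv2 : ‖v.snd‖ ≤ ‖v‖ := WithLp.norm_snd_le _ v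
  have h1 : ‖inner ℂ v.fst u.snd‖ ≤ ‖u‖ * ‖v‖ :=
    (norm_inner_le_norm _ _).trans (by rw [mul_comm]; gcongr)
  have h2 := (hMa u.fst v.snd).trans
    (key Ma _ _ _ _ (norm_nonneg _) (norm_nonneg _) hu1 hv2)
  have h3 := (hMb u.snd v.snd).trans
    (key Mb _ _ _ _ (norm_nonneg _) (norm_nonneg _) hu2 hv2)
  rw [energyForm_apply]
  have h4 := norm_add_le (-inner ℂ v.fst u.snd + a u.fst v.snd) (b u.snd v.snd)
  have h5 := norm_add_le (-inner ℂ v.fst u.snd) (a u.fst v.snd)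
  rw [norm_neg] at h5
  linarith

theorem isElliptic_energyForm (ha : IsContinuousForm a) (hb : IsElliptic j b) :
    IsElliptic (energyEmbedding j) (energyForm a b) := by
  obtain ⟨M, hM⟩ := ha
  obtain ⟨α, hα, ω, hell⟩ := hb
  -- N bounds the two cross terms together. Young's inequality spends α/2 of the coercivity of `b`
  -- on them; the extra α/2 in the shift pays for ‖u₁‖² on the left, as the ambient norm contains
  -- ‖u₁‖ in `V`.
  set N : ℝ := 1 + |M| with hN
  refine ⟨α / 2, by positivity, max (N ^ 2 / (2 * α) + α / 2) ω, fun u => ?_⟩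
  rw [energyForm_apply, Complex.add_re, Complex.add_re, Complex.neg_re,
    WithLp.prod_norm_sq_eq_of_L2, WithLp.prod_norm_sq_eq_of_L2, energyEmbedding_fst,
    energyEmbedding_snd]
  have h1 : (inner ℂ u.fst u.snd).re ≤ ‖u.fst‖ * ‖u.snd‖ := re_inner_le_norm (𝕜 := ℂ) _ _
  have h2 : -(|M| * (‖u.fst‖ * ‖u.snd‖)) ≤ (a u.fst u.snd).re := by
    have h3 := (Complex.abs_re_le_norm (a u.fst u.snd)).trans (hM u.fst u.snd)
    have h4 : M * ‖u.fst‖ * ‖u.snd‖ ≤ |M| * (‖u.fst‖ * ‖u.snd‖) := by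
      rw [mul_assoc]; gcongr; exact le_abs_self M
    linarith [neg_abs_le (a u.fst u.snd).re]
  have h3 := hell u.snd
  have h4 : N * (‖u.fst‖ * ‖u.snd‖) ≤
      N ^ 2 / (2 * α) * ‖u.fst‖ ^ 2 + α / 2 * ‖u.snd‖ ^ 2 := by
    have : N ^ 2 / (2 * α) * ‖u.fst‖ ^ 2 + α / 2 * ‖u.snd‖ ^ 2 - N * (‖u.fst‖ * ‖u.snd‖) =
        (N * ‖u.fst‖ - α * ‖u.snd‖) ^ 2 / (2 * α) := by
      field_simp; ring
    have h5 : 0 ≤ (N * ‖u.fst‖ - α * ‖u.snd‖) ^ 2 / (2 * α) := by positivity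
    linarith
  have h5 := mul_le_mul_of_nonneg_right (le_max_left (N ^ 2 / (2 * α) + α / 2) ω)
    (sq_nonneg ‖u.fst‖)
  have h6 := mul_le_mul_of_nonneg_right (le_max_right (N ^ 2 / (2 * α) + α / 2) ω)
    (sq_nonneg ‖j u.snd‖)
  rw [hN] at h4
  linarith

/-- The componentwise map on a product. -/
def prodMapL2 {E F : Type*} (C : E → E) (D : F → F) (w : WithLp 2 (E × F)) : WithLp 2 (E × F) :=
  WithLp.toLp 2 (C w.fst, D w.snd)

theorem prodMapL2_eq_iff {E F : Type*} {C : E → E} {D : F → F} {w : WithLp 2 (E × F)} :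
    prodMapL2 C D w = w ↔ C w.fst = w.fst ∧ D w.snd = w.snd := by
  rw [← (WithLp.ofLp_injective 2).eq_iff, Prod.ext_iff]; rfl

theorem IsConjugation.prodMapL2 {C : V → V} {D : H → H} (hC : IsConjugation C)
    (hD : IsConjugation D) : IsConjugation (prodMapL2 C D) where
  add _ _ := WithLp.ofLp_injective 2 (Prod.ext (hC.add _ _) (hD.add _ _))
  smul _ _ := WithLp.ofLp_injective 2 (Prod.ext (hC.smul _ _) (hD.smul _ _))
  involutive _ := WithLp.ofLp_injective 2 (Prod.ext (hC.involutive _) (hD.involutive _))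

theorem inner_prodMapL2 {C : V → V} {D : H → H}
    (hC : ∀ x y, inner ℂ (C x) (C y) = inner ℂ y x)
    (hD : ∀ x y, inner ℂ (D x) (D y) = inner ℂ y x) (x y : WithLp 2 (V × H)) :
    inner ℂ (prodMapL2 C D x) (prodMapL2 C D y) = inner ℂ y x := by
  rw [WithLp.prod_inner_apply, WithLp.prod_inner_apply]
  exact congrArg₂ (· + ·) (hC _ _) (hD _ _)

/-- The terms other than `b` already respect the conjugation; pairs with zero first component
isolate `b`. -/
theorem energyForm_prodMapL2_iff {C : V → V} (hC : IsConjugation C)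
    (hCi : ∀ x y, inner ℂ (C x) (C y) = inner ℂ y x)
    (ha : ∀ u v, a (C u) (C v) = starRingEnd ℂ (a u v)) :
    (∀ u v, energyForm a b (prodMapL2 C C u) (prodMapL2 C C v) =
      starRingEnd ℂ (energyForm a b u v)) ↔
      ∀ u v, b (C u) (C v) = starRingEnd ℂ (b u v) := by
  constructor
  · intro h u v
    have := h (WithLp.toLp 2 (0, u)) (WithLp.toLp 2 (0, v))
    simpa [energyForm_apply, prodMapL2, hC.zero] using this
  · intro h u v
    simp only [energyForm_apply, map_add, map_neg, inner_conj_symm]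
    simp [prodMapL2, hCi, ha, h]

end Energy

/-! ### Conjugation of functions -/

section Functions

variable {X : Type*} [MeasurableSpace X] {μ : Measure X} {E : Type*} [AddCommGroup E] [Module ℂ E]
  {ι : E →ₗ[ℂ] (X →ₘ[μ] ℂ)}

theorem coeFn_map_add (u v : E) : ∀ᵐ x ∂μ, ι (u + v) x = ι u x + ι v x := by
  rw [map_add]
  exact AEEqFun.coeFn_add _ _

theorem coeFn_map_smul (c : ℂ) (u : E) : ∀ᵐ x ∂μ, ι (c • u) x = c * ι u x := by
  rw [map_smul]
  exact AEEqFun.coeFn_smul _ _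

theorem eq_of_ae_eq (hι : Function.Injective ι) {u v : E} (h : ∀ᵐ x ∂μ, ι u x = ι v x) : u = v :=
  hι (AEEqFun.ext h)

/-- The complex conjugation of a function space that is stable under `Re`. -/
theorem exists_conjugation (hι : Function.Injective ι) (hre : ∀ u, ∃ p, IsRe ι u p) :
    ∃ C : E → E, IsConjugation C ∧ ∀ u, ∀ᵐ x ∂μ, ι (C u) x = starRingEnd ℂ (ι u x) := by
  choose p hp using hre
  -- The conjugate of u is 2 Re u − u.
  have hC : ∀ u, ∀ᵐ x ∂μ, ι ((2 : ℂ) • p u + (-1 : ℂ) • u) x = starRingEnd ℂ (ι u x) := by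
    intro u
    filter_upwards [hp u, coeFn_map_add (ι := ι) ((2 : ℂ) • p u) ((-1 : ℂ) • u),
      coeFn_map_smul (ι := ι) 2 (p u), coeFn_map_smul (ι := ι) (-1) u] with x h1 h2 h3 h4
    rw [h2, h3, h4, h1]
    apply Complex.ext <;> simp
    ring
  refine ⟨fun u => (2 : ℂ) • p u + (-1 : ℂ) • u, ⟨fun u v => eq_of_ae_eq hι ?_,
    fun c u => eq_of_ae_eq hι ?_, fun u => eq_of_ae_eq hι ?_⟩, hC⟩
  · filter_upwards [hC u, hC v, hC (u + v), coeFn_map_add (ι := ι) u v,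
      coeFn_map_add (ι := ι) ((2 : ℂ) • p u + (-1 : ℂ) • u) ((2 : ℂ) • p v + (-1 : ℂ) • v)]
      with x h1 h2 h3 h4 h5
    rw [h3, h5, h1, h2, h4, map_add]
  · filter_upwards [hC u, hC (c • u), coeFn_map_smul (ι := ι) c u,
      coeFn_map_smul (ι := ι) (starRingEnd ℂ c) ((2 : ℂ) • p u + (-1 : ℂ) • u)] with x h1 h2 h3 h4
    rw [h2, h4, h1, h3, map_mul]
  · filter_upwards [hC u, hC ((2 : ℂ) • p u + (-1 : ℂ) • u)] with x h1 h2
    rw [h2, h1, Complex.conj_conj]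

variable {C : E → E}

theorem mem_realFunctions_iff (hι : Function.Injective ι)
    (hC : ∀ u, ∀ᵐ x ∂μ, ι (C u) x = starRingEnd ℂ (ι u x)) (u : E) :
    u ∈ realFunctions ι ↔ C u = u := by
  refine ⟨fun h => eq_of_ae_eq hι ?_, fun h => ?_⟩
  · filter_upwards [hC u, h] with x h1 h2
    rw [h1, Complex.conj_eq_iff_im.2 h2]
  · have := hC u
    rw [h] at this
    filter_upwards [this] with x h1
    exact Complex.conj_eq_iff_im.1 h1.symm

/-- Two real functions are the real and the imaginary part of a function. -/
theorem isRe_isIm_of_fixed (hC : ∀ u, ∀ᵐ x ∂μ, ι (C u) x = starRingEnd ℂ (ι u x)) {p q : E}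
    (hp : C p = p) (hq : C q = q) :
    IsRe ι (p + Complex.I • q) p ∧ IsIm ι (p + Complex.I • q) q := by
  have h1 := hC p
  have h2 := hC q
  rw [hp] at h1
  rw [hq] at h2
  constructor <;>
  · filter_upwards [h1, h2, coeFn_map_add (ι := ι) p (Complex.I • q),
      coeFn_map_smul (ι := ι) Complex.I q] with x h1 h2 h3 h4
    have h1 := Complex.conj_eq_iff_im.1 h1.symm
    have h2 := Complex.conj_eq_iff_im.1 h2.symm
    rw [h3, h4]
    apply Complex.ext <;> simp [h1, h2]

/-- Reality is assumed only for the real and imaginary parts of one function, but any two fixed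
vectors p, q are those of p + iq. -/
theorem conjugation_form (hC : IsConjugation C)
    (hCι : ∀ u, ∀ᵐ x ∂μ, ι (C u) x = starRingEnd ℂ (ι u x)) {a : E →ₗ[ℂ] E →ₗ⋆[ℂ] ℂ}
    (ha : ∀ u p q : E, IsRe ι u p → IsIm ι u q → (a p q).im = 0) (x y : E) :
    a (C x) (C y) = starRingEnd ℂ (a x y) :=
  hC.map_form (fun p q hp hq => by
    obtain ⟨h1, h2⟩ := isRe_isIm_of_fixed hCι hp hq
    exact ha _ p q h1 h2) x y

end Functions

theorem conjugation_inner {X : Type*} [MeasurableSpace X] {μ : Measure X} {E : Type*}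
    [NormedAddCommGroup E] [InnerProductSpace ℂ E] {ι : E →ₗ[ℂ] (X →ₘ[μ] ℂ)} {C : E → E}
    (hC : IsConjugation C) (hCι : ∀ u, ∀ᵐ x ∂μ, ι (C u) x = starRingEnd ℂ (ι u x))
    (h : ∀ u p q : E, IsRe ι u p → IsIm ι u q → (inner ℂ q p).im = 0) (x y : E) :
    inner ℂ (C x) (C y) = inner ℂ y x := by
  rw [← inner_conj_symm y x]
  exact conjugation_form (a := (innerₛₗ ℂ).flip) hC hCι h y x

end DampedWave

theorem proposition2p6
    {X : Type*} [MeasurableSpace X] (μ : Measure X)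
    {V H : Type*}
    [NormedAddCommGroup V] [InnerProductSpace ℂ V] [CompleteSpace V]
    [TopologicalSpace.SeparableSpace V]
    [NormedAddCommGroup H] [InnerProductSpace ℂ H] [CompleteSpace H]
    [TopologicalSpace.SeparableSpace H]
    -- `H` is a function space over `(X, μ)`, stable under `Re`, with `(Re u ∣ Im u)_H` real
    (ι : H →ₗ[ℂ] (X →ₘ[μ] ℂ)) (hι : Function.Injective ι)
    (hH_re : ∀ u : H, ∃ p : H, IsRe ι u p)
    (hH_inner : ∀ u p q : H, IsRe ι u p → IsIm ι u q → (inner ℂ q p).im = 0)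
    -- `V` is continuously and densely imbedded in `H`
    (j : V →L[ℂ] H) (hj : Function.Injective j) (hj_dense : DenseRange j)
    (a b : V →ₗ[ℂ] V →ₗ⋆[ℂ] ℂ)
    (ha : IsContinuousForm a) (hb : IsContinuousForm b) (hb_ell : IsElliptic j b)
    -- `Re u ∈ V` for all `u ∈ V`
    (hV_re : ∀ u : V, ∃ p : V, IsRe (ι ∘ₗ j.toLinearMap) u p)
    -- `a(Re u, Im u) ∈ ℝ` and `(Re u ∣ Im u)_V ∈ ℝ` for all `u ∈ V`
    (ha_real : ∀ u p q : V, IsRe (ι ∘ₗ j.toLinearMap) u p → IsIm (ι ∘ₗ j.toLinearMap) u q →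
      (a p q).im = 0)
    (hV_inner : ∀ u p q : V, IsRe (ι ∘ₗ j.toLinearMap) u p → IsIm (ι ∘ₗ j.toLinearMap) u q →
      (inner ℂ q p).im = 0) :
    -- both semigroups exist and are uniquely determined, and one is real iff the other is
    (∃! T : ℝ≥0 → WithLp 2 (V × H) →L[ℂ] WithLp 2 (V × H),
      IsSemigroupOfForm (energyEmbedding j) (energyForm a b) T) ∧
    (∃! S : ℝ≥0 → H →L[ℂ] H, IsSemigroupOfForm j b S) ∧
    ∀ (T : ℝ≥0 → WithLp 2 (V × H) →L[ℂ] WithLp 2 (V × H)) (S : ℝ≥0 → H →L[ℂ] H),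
      IsSemigroupOfForm (energyEmbedding j) (energyForm a b) T →
      IsSemigroupOfForm j b S →
      ((∀ (t : ℝ≥0) (w : WithLp 2 (V × H)),
          w.fst ∈ realFunctions (ι ∘ₗ j.toLinearMap) → w.snd ∈ realFunctions ι →
          (T t w).fst ∈ realFunctions (ι ∘ₗ j.toLinearMap) ∧ (T t w).snd ∈ realFunctions ι) ↔
        (∀ (t : ℝ≥0) (w : H), w ∈ realFunctions ι → S t w ∈ realFunctions ι)) := by
  have ha' := isContinuousForm_energyForm ha hb
  have hell' := isElliptic_energyForm ha hb_ell
  have hj' := energyEmbedding_injective hj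
  have hd' := energyEmbedding_denseRange hj_dense
  refine ⟨hell'.existsUnique_semigroup hj' hd' ha',
    hb_ell.existsUnique_semigroup hj hj_dense hb, fun T S hT hS => ?_⟩
  have hιV : Function.Injective (ι ∘ₗ j.toLinearMap) := hι.comp hj
  obtain ⟨CH, hCH, hCHι⟩ := exists_conjugation hι hH_re
  obtain ⟨CV, hCV, hCVι⟩ := exists_conjugation hιV hV_re
  have hCHi := conjugation_inner hCH hCHι hH_inner
  have hCVi := conjugation_inner hCV hCVι hV_inner
  have hCj : ∀ v, j (CV v) = CH (j v) := fun v => eq_of_ae_eq hι <| by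
    filter_upwards [hCHι (j v), hCVι v] with x h1 h2
    rw [h1]
    exact h2
  simp only [mem_realFunctions_iff hι hCHι, mem_realFunctions_iff hιV hCVι]
  -- Both invariance statements become reality of a form, where they meet; the real pairs are the
  -- fixed vectors of the product conjugation.
  rw [hS.forall_fixed_iff hj hj_dense hb hb_ell hCV hCH hCVi hCHi hCj,
    ← energyForm_prodMapL2_iff hCV hCVi (conjugation_form hCV hCVι ha_real),
    ← hT.forall_fixed_iff hj' hd' ha' hell' (hCV.prodMapL2 hCV) (hCV.prodMapL2 hCH)
      (inner_prodMapL2 hCVi hCVi) (inner_prodMapL2 hCVi hCHi)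
      (fun v => WithLp.ofLp_injective 2 (Prod.ext rfl (hCj v.snd)))]
  simp only [prodMapL2_eq_iff, and_imp]
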